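/- Let $\{\phi_t\}_{t\in\mathbb Z^d}$ be a nonsingular action on a standard Borel space $(S,\mathcal S)$ with a $\sigma$-finite measure $\mu$: each $\phi_t:S\to S$ is measurable, $\phi_0=\mathrm{id}$, $\phi_{u+v}=\phi_u\circ\phi_v$, and $\mu\circ\phi_t^{-1}\sim\mu$. A measurable set $W\subseteq S$ is wandering if the sets $\phi_t^{-1}(W)$, $t\in\mathbb Z^d$, are pairwise disjoint. The action is conservative if every wandering set is $\mu$-null, and dissipative if $S=\bigcup_{t}\phi_t^{-1}(W)$ modulo $\mu$ for some wandering set $W$. For $g\in L^1(\mu)$ let $$\hat\phi_t g(s)=g(\phi_t(s))\,\frac{d(\mu\circ\phi_t)}{d\mu}(s).$$ Inequalities in $\mathbb Z^d$ are coordinatewise and $\mathbf 1=(1,\dots,1)$. For $g\in L^1(\mu)$ with $g\ge 0$ the functions $\max_{0\le t\le (n-1)\mathbf 1}\hat\phi_t g$, $n\ge1$, are $\mu$-integrable, and the following hold. (a) If the action is conservative, then for all $g\in L^1(\mu)$ with $g\ge 0$, $$\frac1{n^d}\int_S\max_{0\le t\le (n-1)\mathbf 1}\hat\phi_t g(s)\,\mu(ds)\to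 0\qquad(n\to\infty).$$ (b) If the action is dissipative, then for all $g\in L^1(\mu)$ with $g\ge 0$ and $\mu(g>0)>0$, $$\frac1{n^d}\int_S\max_{0\le t\le (n-1)\mathbf 1}\hat\phi_t g(s)\,\mu(ds)\to a\qquad(n\to\infty)$$ for some $0<a<\infty$. Moreover, let $(W,\mathcal W,\tau)$ be a $\sigma$-finite standard measure space, let $l$ be the counting measure on $\mathbb Z^d$, and let $\psi_t(w,s)=(w,t+s)$ on $(W\times\mathbb Z^d,\tau\otimes l)$. Then for all $f\in L^1(\tau\otimes l)$ with $f\ge0$ and $(\tau\otimes l)(f>0)>0$, $$\frac1{n^d}\int_{W\times\mathbb Z^d}\max_{0\le t\le (n-1)\mathbf 1}\hat\psi_t f\,d(\tau\otimes l)\to\int_W\sup_{s\in\mathbb Z^d}f(w,s)\,\tau(dw)\in(0,\infty)\qquad(n\to\infty).$$ -/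

import Mathlib

open MeasureTheory Filter Topology

noncomputable section

namespace ZdAction

variable {d : ℕ} {S : Type*} [MeasurableSpace S]

/-- A nonsingular `ℤ^d`-action on the measure space `(S, μ)`: a family of measurable maps
`φ_t : S → S`, `t ∈ ℤ^d`, with `φ_0 = id`, `φ_{u+v} = φ_u ∘ φ_v`, such that `μ ∘ φ_t⁻¹` and `μ`
are mutually absolutely continuous for every `t`. -/
structure IsNonsingularAction (φ : (Fin d → ℤ) → S → S) (μ : Measure S) : Prop where
  measurable : ∀ t, Measurable (φ t)
  map_zero : ∀ s, φ 0 s = s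
  map_add : ∀ u v s, φ (u + v) s = φ u (φ v s)
  map_absolutelyContinuous : ∀ t, μ.map (φ t) ≪ μ
  absolutelyContinuous_map : ∀ t, μ ≪ μ.map (φ t)

/-- A wandering set: a measurable set whose translates under the action are pairwise disjoint. -/
structure IsWandering (φ : (Fin d → ℤ) → S → S) (W : Set S) : Prop where
  measurableSet : MeasurableSet W
  pairwise_disjoint : Pairwise fun u v : Fin d → ℤ => Disjoint (φ u ⁻¹' W) (φ v ⁻¹' W)

/-- The action is conservative: there is no wandering set of positive measure. -/
def IsConservative (φ : (Fin d → ℤ) → S → S) (μ : Measure S) : Prop :=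
  ∀ W : Set S, IsWandering φ W → μ W = 0

/-- The action is dissipative: modulo `μ`, the space is the union of the translates of one
wandering set. -/
def IsDissipative (φ : (Fin d → ℤ) → S → S) (μ : Measure S) : Prop :=
  ∃ W : Set S, IsWandering φ W ∧ μ (⋃ t : Fin d → ℤ, φ t ⁻¹' W)ᶜ = 0

/-- The measure `μ ∘ φ_t : A ↦ μ (φ_t(A))`, realized as the image of `μ` under
`φ_{-t} = φ_t⁻¹`; see `compMeasure_apply`. -/
def compMeasure (φ : (Fin d → ℤ) → S → S) (μ : Measure S) (t : Fin d → ℤ) : Measure S :=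
  μ.map (φ (-t))

theorem compMeasure_apply {φ : (Fin d → ℤ) → S → S} {μ : Measure S}
    (hφ : IsNonsingularAction φ μ) (t : Fin d → ℤ) {A : Set S} (hA : MeasurableSet A) :
    compMeasure φ μ t A = μ (φ t '' A) := by
  rw [compMeasure, Measure.map_apply (hφ.measurable _) hA]
  congr 1
  ext s
  constructor
  · intro hs
    refine ⟨φ (-t) s, hs, ?_⟩
    rw [← hφ.map_add, add_neg_cancel, hφ.map_zero]
  · rintro ⟨a, ha, rfl⟩
    have h : φ (-t) (φ t a) = a := by rw [← hφ.map_add, neg_add_cancel, hφ.map_zero]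
    simpa [h] using ha

/-- The dual operator `φ̂_t g = (g ∘ φ_t) · d(μ ∘ φ_t)/dμ`. -/
def dualOp (φ : (Fin d → ℤ) → S → S) (μ : Measure S) (t : Fin d → ℤ) (g : S → ℝ) (s : S) : ℝ :=
  g (φ t s) * ((compMeasure φ μ t).rnDeriv μ s).toReal

/-- `max_{0 ≤ t ≤ (n-1)𝟏} φ̂_t g(s)`, for the coordinatewise order on `ℤ^d`. The index set is
finite, and it is nonempty for `n ≥ 1`, so that the supremum is a maximum. -/
def maxDual (φ : (Fin d → ℤ) → S → S) (μ : Measure S) (n : ℕ) (g : S → ℝ) (s : S) : ℝ :=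
  ⨆ t : Set.Icc (0 : Fin d → ℤ) (fun _ => (n : ℤ) - 1), dualOp φ μ (t : Fin d → ℤ) g s

/-- The shift `ψ_t (w, s) = (w, t + s)` on `W × ℤ^d`. -/
def krengelAction {W : Type*} (t : Fin d → ℤ) (p : W × (Fin d → ℤ)) : W × (Fin d → ℤ) :=
  (p.1, t + p.2)

end ZdAction

end

/-! Break ties lexicographically, so that a maximum over a finite set `F` of times is the value at
its unique first maximizer. By the cocycle identity for d(μ∘φ_t)/dμ, the time `t` is the first
maximizer over `F` along the orbit of `s` exactly when 0 is the first maximizer over `F - t` along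
the orbit of `φ t s`. Since the dual operators preserve integrals, the integral of the maximum is
the sum over `t ∈ F` of the masses, under `G dμ`, of the sets `peakSet φ μ G (F - t)`. For the box
of side `n`, most translates `F - t` contain a given cube around 0, so the average tends to the `G
dμ`-mass of the points where 0 is the first maximizer over all of ℤ^d
(`tendsto_lintegral_iSup_transfer`). An orbit has at most one first maximizer, so this limit set is
wandering up to a null set, and the limit is 0 in the conservative case. In the dissipative case the
orbit sums of `G` are finite a.e., so maxima are attained and the limit is positive. For the shift,
integrating over each fibre evaluates the limit as the integral of the supremum. -/

noncomputable section

namespace ZdAction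

open scoped ENNReal

variable {d : ℕ} {S : Type*} [MeasurableSpace S]

/-! ### First maximizers of functions on `ℤ^d` -/

/-- The value of `h` at `t` dominates the values on `F`, strictly at the lexicographic predecessors
of `t`. -/
def IsPeak (F : Set (Fin d → ℤ)) (h : (Fin d → ℤ) → ℝ≥0∞) (t : Fin d → ℤ) : Prop :=
  ∀ r ∈ F, h r ≤ h t ∧ (toLex r < toLex t → h r < h t)

theorem IsPeak.mono {F F' : Set (Fin d → ℤ)} (hF : F ⊆ F') {h : (Fin d → ℤ) → ℝ≥0∞}
    {t : Fin d → ℤ} (ht : IsPeak F' h t) : IsPeak F h t :=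
  fun r hr => ht r (hF hr)

/-- Of two peaks, the lexicographically later one would strictly exceed the earlier, which is itself
maximal. -/
theorem IsPeak.eq {F : Set (Fin d → ℤ)} {h : (Fin d → ℤ) → ℝ≥0∞} {t u : Fin d → ℤ}
    (ht : IsPeak F h t) (hu : IsPeak F h u) (htF : t ∈ F) (huF : u ∈ F) : t = u := by
  by_contra hne
  rcases lt_trichotomy (toLex t) (toLex u) with hlt | heq | hlt
  · exact absurd ((hu t htF).2 hlt) (not_lt.2 (ht u huF).1)
  · exact hne (toLex.injective heq)
  · exact absurd ((ht u huF).2 hlt) (not_lt.2 (hu t htF).1)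

/-- Summability leaves finitely many values at least `h q > 0`. This gives both a maximum and a
lexicographically least maximizer, although the lexicographic order on ℤ^d need not be well-founded.
-/
theorem exists_isPeak {F : Set (Fin d → ℤ)} {h : (Fin d → ℤ) → ℝ≥0∞}
    (hsum : ∑' t, F.indicator h t ≠ ∞) {q : Fin d → ℤ} (hqF : q ∈ F) (hq : h q ≠ 0) :
    ∃ t ∈ F, IsPeak F h t ∧ h q ≤ h t := by
  have hfin : {t | h q ≤ F.indicator h t}.Finite :=
    ENNReal.finite_const_le_of_tsum_ne_top hsum hq
  have hmem : ∀ t, t ∈ {t | h q ≤ F.indicator h t} ↔ t ∈ F ∧ h q ≤ h t := by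
    intro t
    by_cases ht : t ∈ F <;> simp [ht, hq]
  obtain ⟨m, hm, hmax⟩ := Set.exists_max_image _ h hfin ⟨q, (hmem q).2 ⟨hqF, le_rfl⟩⟩
  obtain ⟨t, ⟨ht, htm⟩, hmin⟩ := Set.exists_min_image
    ({t | h q ≤ F.indicator h t} ∩ {t | h t = h m}) toLex (hfin.inter_of_left _) ⟨m, hm, rfl⟩
  have htm : h t = h m := htm
  have hle : ∀ r ∈ F, h r ≤ h m := fun r hr => by
    by_cases hqr : h q ≤ h r
    · exact hmax r ((hmem r).2 ⟨hr, hqr⟩)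
    · exact (not_le.1 hqr).le.trans (hmax q ((hmem q).2 ⟨hqF, le_rfl⟩))
  refine ⟨t, ((hmem t).1 ht).1, fun r hr => ⟨htm ▸ hle r hr, fun hrt => ?_⟩, ((hmem t).1 ht).2⟩
  refine lt_of_le_of_ne (htm ▸ hle r hr) fun heq => not_lt.2 (hmin r ⟨(hmem r).2 ⟨hr, ?_⟩, ?_⟩) hrt
  · exact heq ▸ ((hmem t).1 ht).2
  · exact heq.trans htm

open Classical in
/-- A supremum is the value at the first maximizer, written as a sum. -/
theorem tsum_isPeak_eq_iSup {F : Set (Fin d → ℤ)} {h : (Fin d → ℤ) → ℝ≥0∞}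
    (hsum : ∑' t, F.indicator h t ≠ ∞) :
    ∑' t, (if t ∈ F ∧ IsPeak F h t then h t else 0) = ⨆ t ∈ F, h t := by
  -- If `h` vanishes on an infinite `F` there may be no peak, but both sides are then 0.
  by_cases h0 : ∀ t ∈ F, h t = 0
  · have h1 : ⨆ t ∈ F, h t = 0 := by simpa using h0
    rw [h1, ENNReal.tsum_eq_zero]
    intro t
    split_ifs with ht
    · exact h0 t ht.1
    · rfl
  · push Not at h0
    obtain ⟨q, hqF, hq⟩ := h0
    obtain ⟨t, htF, ht, -⟩ := exists_isPeak hsum hqF hq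
    rw [tsum_eq_single t, if_pos ⟨htF, ht⟩]
    · exact le_antisymm (le_iSup₂_of_le t htF le_rfl) (iSup₂_le fun r hr => (ht r hr).1)
    · intro u hu
      rw [if_neg]
      rintro ⟨huF, hu'⟩
      exact hu (hu'.eq ht huF htF)

/-- Translation respects the lexicographic order, and a common factor in `(0, ∞)` respects both `≤`
and `<`. -/
theorem isPeak_add_iff {F : Set (Fin d → ℤ)} {h h' : (Fin d → ℤ) → ℝ≥0∞} {t : Fin d → ℤ}
    {c : ℝ≥0∞} (hc : c ≠ 0) (hc' : c ≠ ∞) (hh : ∀ r, h (r + t) = h' r * c) :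
    IsPeak F h t ↔ IsPeak {r | r + t ∈ F} h' 0 := by
  have h0 : h t = h' 0 * c := by simpa using hh 0
  have key : ∀ r, (h (r + t) ≤ h t ∧ (toLex (r + t) < toLex t → h (r + t) < h t)) ↔
      (h' r ≤ h' 0 ∧ (toLex r < toLex 0 → h' r < h' 0)) := by
    intro r
    have hlex : toLex (r + t) < toLex t ↔ toLex r < toLex 0 := by
      rw [toLex_add, toLex_zero, add_lt_iff_neg_right]
    rw [hh, h0, hlex, ENNReal.mul_le_mul_iff_left hc hc', ENNReal.mul_lt_mul_iff_left hc hc']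
  constructor
  · intro hp r hr
    exact (key r).1 (hp _ hr)
  · intro hp r hr
    have := (key (r - t)).2 (hp _ (by simpa using hr))
    simpa using this

/-! ### The dual operator on `[0, ∞]`-valued functions -/

/-- The Radon–Nikodym cocycle `d(μ ∘ φ_t)/dμ`. -/
def jac (φ : (Fin d → ℤ) → S → S) (μ : Measure S) (t : Fin d → ℤ) : S → ℝ≥0∞ :=
  (compMeasure φ μ t).rnDeriv μ

/-- The `[0, ∞]`-valued version of `dualOp`. -/
def transfer (φ : (Fin d → ℤ) → S → S) (μ : Measure S) (t : Fin d → ℤ) (G : S → ℝ≥0∞) (s : S) :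
    ℝ≥0∞ :=
  G (φ t s) * jac φ μ t s

theorem measurable_jac (φ : (Fin d → ℤ) → S → S) (μ : Measure S) (t : Fin d → ℤ) :
    Measurable (jac φ μ t) :=
  Measure.measurable_rnDeriv _ _

namespace IsNonsingularAction

variable {φ : (Fin d → ℤ) → S → S} {μ : Measure S} (hφ : IsNonsingularAction φ μ)

include hφ

theorem neg_apply (t : Fin d → ℤ) (s : S) : φ (-t) (φ t s) = s := by
  rw [← hφ.map_add, neg_add_cancel, hφ.map_zero]

theorem apply_neg (t : Fin d → ℤ) (s : S) : φ t (φ (-t) s) = s := by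
  rw [← hφ.map_add, add_neg_cancel, hφ.map_zero]

theorem quasiMeasurePreserving (t : Fin d → ℤ) : Measure.QuasiMeasurePreserving (φ t) μ μ :=
  ⟨hφ.measurable t, hφ.map_absolutelyContinuous t⟩

theorem ae_all_comp {p : S → Prop} (hp : ∀ᵐ s ∂μ, p s) : ∀ᵐ s ∂μ, ∀ t, p (φ t s) :=
  ae_all_iff.2 fun t => (hφ.quasiMeasurePreserving t).ae hp

theorem sigmaFinite_compMeasure [SigmaFinite μ] (t : Fin d → ℤ) :
    SigmaFinite (compMeasure φ μ t) :=
  let e : S ≃ᵐ S :=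
    { toFun := φ (-t)
      invFun := φ t
      left_inv := hφ.apply_neg t
      right_inv := hφ.neg_apply t
      measurable_toFun := hφ.measurable _
      measurable_invFun := hφ.measurable _ }
  e.sigmaFinite_map

theorem measurable_transfer (t : Fin d → ℤ) {G : S → ℝ≥0∞} (hG : Measurable G) :
    Measurable (transfer φ μ t G) :=
  (hG.comp (hφ.measurable t)).mul (measurable_jac φ μ t)

theorem lintegral_mul_jac [SigmaFinite μ] (t : Fin d → ℤ) {H : S → ℝ≥0∞} (hH : Measurable H) :
    ∫⁻ s, H s * jac φ μ t s ∂μ = ∫⁻ s, H (φ (-t) s) ∂μ := by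
  have := hφ.sigmaFinite_compMeasure t
  simp_rw [mul_comm (H _)]
  have hac : compMeasure φ μ t ≪ μ := hφ.map_absolutelyContinuous _
  rw [jac, lintegral_rnDeriv_mul hac hH.aemeasurable, compMeasure,
    lintegral_map hH (hφ.measurable _)]

theorem lintegral_transfer [SigmaFinite μ] (t : Fin d → ℤ) {G : S → ℝ≥0∞} (hG : Measurable G) :
    ∫⁻ s, transfer φ μ t G s ∂μ = ∫⁻ s, G s ∂μ := by
  refine (hφ.lintegral_mul_jac t (hG.comp (hφ.measurable t))).trans ?_
  simp_rw [Function.comp_apply, hφ.apply_neg]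

/-- Chain rule: by change of variables, both sides have the same integral over every measurable set
`B`. -/
theorem jac_add_ae [SigmaFinite μ] (u v : Fin d → ℤ) :
    ∀ᵐ s ∂μ, jac φ μ (u + v) s = jac φ μ u (φ v s) * jac φ μ v s := by
  have hm : Measurable fun s => jac φ μ u (φ v s) * jac φ μ v s :=
    hφ.measurable_transfer v (measurable_jac φ μ u)
  refine ae_eq_of_forall_setLIntegral_eq_of_sigmaFinite (measurable_jac _ _ _) hm
    fun B hB _ => ?_
  rw [← lintegral_indicator hB, ← lintegral_indicator hB]
  have h1 : ∀ s, B.indicator (jac φ μ (u + v)) s = B.indicator 1 s * jac φ μ (u + v) s := by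
    intro s; by_cases hs : s ∈ B <;> simp [hs]
  have h2 : ∀ s, B.indicator (fun s => jac φ μ u (φ v s) * jac φ μ v s) s =
      (B.indicator 1 s * jac φ μ u (φ v s)) * jac φ μ v s := by
    intro s; by_cases hs : s ∈ B <;> simp [hs]
  have hB1 : Measurable (B.indicator (1 : S → ℝ≥0∞)) := measurable_one.indicator hB
  simp_rw [h1, h2]
  rw [hφ.lintegral_mul_jac _ hB1]
  refine Eq.trans ?_ (hφ.lintegral_mul_jac v
    (hB1.mul ((measurable_jac φ μ u).comp (hφ.measurable v)))).symm
  simp_rw [Pi.mul_apply, Function.comp_apply, hφ.apply_neg]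
  refine Eq.trans ?_ (hφ.lintegral_mul_jac u (hB1.comp (hφ.measurable (-v)))).symm
  simp_rw [Function.comp_apply, ← hφ.map_add, neg_add_rev]

theorem jac_zero_ae [SigmaFinite μ] : ∀ᵐ s ∂μ, jac φ μ 0 s = 1 := by
  have h : compMeasure φ μ 0 = μ := by
    have : φ (-0) = id := by
      ext s
      rw [neg_zero, hφ.map_zero, id]
    rw [compMeasure, this, Measure.map_id]
  rw [jac, h]
  exact Measure.rnDeriv_self μ

end IsNonsingularAction

/-- The points along whose orbit the Radon–Nikodym derivatives form a cocycle with values in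
`(0, ∞)`. -/
structure IsRegularPoint (φ : (Fin d → ℤ) → S → S) (μ : Measure S) (s : S) : Prop where
  jac_add : ∀ u v, jac φ μ (u + v) s = jac φ μ u (φ v s) * jac φ μ v s
  jac_ne_zero : ∀ t, jac φ μ t s ≠ 0
  jac_ne_top : ∀ t, jac φ μ t s ≠ ∞
  jac_zero : jac φ μ 0 s = 1

namespace IsNonsingularAction

variable {φ : (Fin d → ℤ) → S → S} {μ : Measure S} (hφ : IsNonsingularAction φ μ)

include hφ

theorem ae_isRegularPoint [SigmaFinite μ] : ∀ᵐ s ∂μ, IsRegularPoint φ μ s := by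
  have h1 : ∀ᵐ s ∂μ, ∀ u v, jac φ μ (u + v) s = jac φ μ u (φ v s) * jac φ μ v s :=
    ae_all_iff.2 fun u => ae_all_iff.2 fun v => hφ.jac_add_ae u v
  have h2 : ∀ᵐ s ∂μ, ∀ t, jac φ μ t s < ∞ := ae_all_iff.2 fun t => by
    have := hφ.sigmaFinite_compMeasure t
    exact Measure.rnDeriv_lt_top _ _
  filter_upwards [h1, h2, hφ.jac_zero_ae] with s h1 h2 h0
  -- The cocycle identity for `-t + t = 0` has left side 1, so no factor can vanish.
  refine ⟨h1, fun t ht => ?_, fun t => (h2 t).ne, h0⟩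
  have := h1 (-t) t
  rw [neg_add_cancel, h0, ht, mul_zero] at this
  exact one_ne_zero this

theorem transfer_add_apply {s : S} (hs : IsRegularPoint φ μ s) (G : S → ℝ≥0∞)
    (r t : Fin d → ℤ) :
    transfer φ μ (r + t) G s = transfer φ μ r G (φ t s) * jac φ μ t s := by
  rw [transfer, transfer, hs.jac_add, hφ.map_add, mul_assoc]

theorem isPeak_transfer_iff {s : S} (hs : IsRegularPoint φ μ s) (G : S → ℝ≥0∞)
    (F : Set (Fin d → ℤ)) (t : Fin d → ℤ) :
    IsPeak F (fun r => transfer φ μ r G s) t ↔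
      IsPeak {r | r + t ∈ F} (fun r => transfer φ μ r G (φ t s)) 0 :=
  isPeak_add_iff (hs.jac_ne_zero t) (hs.jac_ne_top t) fun r => hφ.transfer_add_apply hs G r t

theorem transfer_zero {s : S} (hs : IsRegularPoint φ μ s) (G : S → ℝ≥0∞) :
    transfer φ μ 0 G s = G s := by
  rw [transfer, hφ.map_zero, hs.jac_zero, mul_one]

end IsNonsingularAction

/-- The points at which `t = 0` is the first maximizer of `t ↦ φ̂_t G` in comparison with `F`. -/
def peakSet (φ : (Fin d → ℤ) → S → S) (μ : Measure S) (G : S → ℝ≥0∞) (F : Set (Fin d → ℤ)) :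
    Set S :=
  {s | IsPeak F (fun r => transfer φ μ r G s) 0}

theorem peakSet_anti (φ : (Fin d → ℤ) → S → S) (μ : Measure S) (G : S → ℝ≥0∞) :
    Antitone (peakSet φ μ G) :=
  fun _ _ hF _ hs => IsPeak.mono hF hs

theorem IsNonsingularAction.measurableSet_peakSet {φ : (Fin d → ℤ) → S → S} {μ : Measure S}
    (hφ : IsNonsingularAction φ μ) {G : S → ℝ≥0∞} (hG : Measurable G) (F : Set (Fin d → ℤ)) :
    MeasurableSet (peakSet φ μ G F) := by
  have : peakSet φ μ G F = ⋂ r ∈ F, ({s | transfer φ μ r G s ≤ transfer φ μ 0 G s} ∩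
      {s | toLex r < toLex 0 → transfer φ μ r G s < transfer φ μ 0 G s}) := by
    ext s
    simp only [peakSet, IsPeak, Set.mem_ofPred_eq, Set.mem_iInter, Set.mem_inter_iff]
  rw [this]
  refine MeasurableSet.biInter (Set.to_countable F) fun r _ => ?_
  have h1 := hφ.measurable_transfer r hG
  have h0 := hφ.measurable_transfer 0 hG
  refine (measurableSet_le h1 h0).inter ?_
  by_cases hr : toLex r < toLex (0 : Fin d → ℤ)
  · simpa only [hr, true_imp_iff] using measurableSet_lt h1 h0
  · simp only [hr, false_imp_iff, Set.ofPred_true, MeasurableSet.univ]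

/-! ### The limit of the averaged maxima -/

/-- The box `{0, …, n-1}^d`. -/
def box (d n : ℕ) : Finset (Fin d → ℤ) :=
  Finset.Icc 0 fun _ => (n : ℤ) - 1

theorem card_box (d n : ℕ) : (box d n).card = n ^ d := by
  simp [box, Pi.card_Icc]

/-- The box `{k, …, n-1-k}^d`. -/
def innerBox (d n k : ℕ) : Finset (Fin d → ℤ) :=
  Finset.Icc (fun _ => (k : ℤ)) fun _ => (n : ℤ) - 1 - k

theorem card_innerBox (d n k : ℕ) : (innerBox d n k).card = (n - 2 * k) ^ d := by
  -- Truncated subtraction matches an empty interval when `n < 2k`.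
  have : ((n : ℤ) - 1 - k + 1 - k).toNat = n - 2 * k := by omega
  simp [innerBox, Pi.card_Icc, this]

theorem innerBox_subset (d n k : ℕ) : innerBox d n k ⊆ box d n := by
  intro t ht
  simp only [innerBox, box, Finset.mem_Icc, Pi.le_def, Pi.zero_apply] at ht ⊢
  exact ⟨fun i => by have := ht.1 i; omega, fun i => by have := ht.2 i; omega⟩

theorem add_mem_box {n k : ℕ} {r t : Fin d → ℤ} (ht : t ∈ innerBox d n k)
    (hr : r ∈ Set.Icc (fun _ => -(k : ℤ)) fun _ : Fin d => (k : ℤ)) : r + t ∈ box d n := by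
  simp only [innerBox, box, Finset.mem_Icc, Set.mem_Icc, Pi.le_def, Pi.zero_apply,
    Pi.add_apply] at ht hr ⊢
  exact ⟨fun i => by have := ht.1 i; have := hr.1 i; omega,
    fun i => by have := ht.2 i; have := hr.2 i; omega⟩

theorem iUnion_Icc_neg_self (d : ℕ) :
    ⋃ k : ℕ, Set.Icc (fun _ => -(k : ℤ)) (fun _ : Fin d => (k : ℤ)) = Set.univ := by
  refine Set.eq_univ_of_forall fun r => Set.mem_iUnion.2 ⟨∑ i, (r i).natAbs, ?_⟩
  have h : ∀ i, (r i).natAbs ≤ ∑ i, (r i).natAbs := fun i =>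
    Finset.single_le_sum (f := fun i => (r i).natAbs) (fun _ _ => Nat.zero_le _)
      (Finset.mem_univ i)
  exact ⟨fun i => by have := h i; simp only; omega, fun i => by have := h i; simp only; omega⟩

theorem tendsto_sub_div_pow (d k : ℕ) :
    Tendsto (fun n : ℕ => (((n - 2 * k : ℕ) : ℝ) / n) ^ d) atTop (𝓝 1) := by
  have h : Tendsto (fun n : ℕ => 1 - (2 * k : ℝ) / n) atTop (𝓝 (1 - 0)) :=
    tendsto_const_nhds.sub (tendsto_const_div_atTop_nhds_zero_nat _)
  have h' : Tendsto (fun n : ℕ => ((n - 2 * k : ℕ) : ℝ) / n) atTop (𝓝 1) := by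
    rw [sub_zero] at h
    refine h.congr' ?_
    filter_upwards [eventually_ge_atTop (2 * k), eventually_gt_atTop 0] with n hn hn0
    have : (n : ℝ) ≠ 0 := by positivity
    rw [Nat.cast_sub hn]
    push_cast
    field_simp
  simpa using h'.pow d

/-- A sandwich with an error that vanishes in two successive limits. -/
theorem tendsto_of_le_add {x : ℕ → ℝ} {e : ℕ → ℕ → ℝ} {b : ℕ → ℝ} {c : ℝ}
    (hb : Tendsto b atTop (𝓝 c)) (he : ∀ k, Tendsto (e k) atTop (𝓝 0))
    (hl : ∀ᶠ n in atTop, c ≤ x n) (hu : ∀ k, ∀ᶠ n in atTop, x n ≤ b k + e k n) :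
    Tendsto x atTop (𝓝 c) := by
  rw [tendsto_order]
  refine ⟨fun a ha => hl.mono fun n hn => ha.trans_le hn, fun a ha => ?_⟩
  obtain ⟨k, hk⟩ := (hb.eventually (gt_mem_nhds ha)).exists
  have h := (tendsto_const_nhds (x := b k)).add (he k)
  rw [add_zero] at h
  filter_upwards [hu k, h.eventually (gt_mem_nhds hk)] with n h1 h2
  exact h1.trans_lt h2

namespace IsNonsingularAction

variable {φ : (Fin d → ℤ) → S → S} {μ : Measure S}

theorem ae_transfer_ne_top (hφ : IsNonsingularAction φ μ) [SigmaFinite μ] {G : S → ℝ≥0∞}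
    (hG : Measurable G) (hfin : ∫⁻ s, G s ∂μ ≠ ∞) : ∀ᵐ s ∂μ, ∀ t, transfer φ μ t G s ≠ ∞ :=
  ae_all_iff.2 fun t => (ae_lt_top (hφ.measurable_transfer t hG)
    (by rwa [hφ.lintegral_transfer t hG])).mono fun _ h => h.ne

/-- The maximum is a sum over `t` of values at first maximizers. Moving the base point to `φ t s`
turns each term into the dual operator at `t` applied to `G` restricted to a peak set, and that
operator preserves the integral. -/
theorem lintegral_iSup_transfer (hφ : IsNonsingularAction φ μ) [SigmaFinite μ] {G : S → ℝ≥0∞}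
    (hG : Measurable G) (hfin : ∫⁻ s, G s ∂μ ≠ ∞) (F : Finset (Fin d → ℤ)) :
    ∫⁻ s, ⨆ t ∈ F, transfer φ μ t G s ∂μ =
      ∑ t ∈ F, μ.withDensity G (peakSet φ μ G {r | r + t ∈ F}) := by
  classical
  have hA := fun t : Fin d → ℤ => hφ.measurableSet_peakSet hG {r | r + t ∈ F}
  have key : ∀ᵐ s ∂μ, ⨆ t ∈ F, transfer φ μ t G s =
      ∑ t ∈ F, transfer φ μ t ((peakSet φ μ G {r | r + t ∈ F}).indicator G) s := by
    filter_upwards [hφ.ae_isRegularPoint, hφ.ae_transfer_ne_top hG hfin] with s hs hs'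
    have hsum : ∑' t, (F : Set (Fin d → ℤ)).indicator (fun t => transfer φ μ t G s) t ≠ ∞ := by
      rw [← sum_eq_tsum_indicator]
      exact ENNReal.sum_ne_top.2 fun t _ => hs' t
    have h := tsum_isPeak_eq_iSup hsum
    simp only [Finset.mem_coe] at h
    rw [← h, tsum_eq_sum (s := F) fun t ht => if_neg fun h => ht h.1]
    refine Finset.sum_congr rfl fun t ht => ?_
    have hiff := hφ.isPeak_transfer_iff hs G (F : Set (Fin d → ℤ)) t
    by_cases hp : φ t s ∈ peakSet φ μ G {r | r + t ∈ F}
    · rw [if_pos ⟨ht, hiff.2 hp⟩, transfer, transfer, Set.indicator_of_mem hp]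
    · rw [if_neg fun h => hp (hiff.1 h.2), transfer, Set.indicator_of_notMem hp, zero_mul]
  rw [lintegral_congr_ae key,
    lintegral_finsetSum _ fun t _ => hφ.measurable_transfer t (hG.indicator (hA t))]
  refine Finset.sum_congr rfl fun t _ => ?_
  rw [hφ.lintegral_transfer t (hG.indicator (hA t)), lintegral_indicator (hA t),
    withDensity_apply _ (hA t)]

theorem tendsto_lintegral_iSup_transfer (hφ : IsNonsingularAction φ μ) [SigmaFinite μ]
    {G : S → ℝ≥0∞} (hG : Measurable G) (hfin : ∫⁻ s, G s ∂μ ≠ ∞) :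
    Tendsto (fun n : ℕ => 1 / (n : ℝ) ^ d *
        (∫⁻ s, ⨆ t ∈ box d n, transfer φ μ t G s ∂μ).toReal) atTop
      (𝓝 (∫⁻ s in peakSet φ μ G Set.univ, G s ∂μ).toReal) := by
  have := isFiniteMeasure_withDensity hfin
  set ν := μ.withDensity G with hν
  have hA := hφ.measurableSet_peakSet hG
  set K : ℕ → Set (Fin d → ℤ) := fun k => Set.Icc (fun _ => -(k : ℤ)) fun _ => (k : ℤ) with hK
  have hmono : Monotone K := fun k l hkl =>
    Set.Icc_subset_Icc (fun _ => by simp only; omega) (fun _ => by simp only; omega)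
  have hInter : ⋂ k, peakSet φ μ G (K k) = peakSet φ μ G Set.univ := by
    rw [← iUnion_Icc_neg_self d]
    ext s
    simp only [peakSet, IsPeak, Set.mem_iInter, Set.mem_ofPred_eq, Set.mem_iUnion]
    exact ⟨fun h r ⟨k, hk⟩ => h k r hk, fun h k r hr => h r ⟨k, hr⟩⟩
  rw [← withDensity_apply _ (hA _), ← hν]
  have hb : Tendsto (fun k => ν.real (peakSet φ μ G (K k))) atTop
      (𝓝 (ν (peakSet φ μ G Set.univ)).toReal) := by
    rw [← hInter]
    exact (ENNReal.tendsto_toReal (measure_ne_top _ _)).comp (tendsto_measure_iInter_atTop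
      (fun k => (hA _).nullMeasurableSet) (fun k l hkl => peakSet_anti φ μ G (hmono hkl))
      ⟨0, measure_ne_top _ _⟩)
  have hI : ∀ n, (∫⁻ s, ⨆ t ∈ box d n, transfer φ μ t G s ∂μ).toReal =
      ∑ t ∈ box d n, ν.real (peakSet φ μ G {r | r + t ∈ box d n}) := fun n => by
    rw [hφ.lintegral_iSup_transfer hG hfin, ENNReal.toReal_sum fun _ _ => measure_ne_top _ _]
    rfl
  -- The error is the proportion of the box outside the inner box, each such `t` contributing at
  -- most the total mass.
  refine tendsto_of_le_add hb
    (e := fun k n => (1 - (((n - 2 * k : ℕ) : ℝ) / n) ^ d) * ν.real Set.univ) (fun k => ?_) ?_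
    fun k => ?_
  · have := ((tendsto_const_nhds (x := (1 : ℝ))).sub (tendsto_sub_div_pow d k)).mul_const
      (ν.real Set.univ)
    simpa using this
  -- Comparing with fewer times enlarges the peak set, so each term is at least the limit.
  · filter_upwards [eventually_gt_atTop 0] with n hn
    have hn' : (0 : ℝ) < (n : ℝ) ^ d := by positivity
    have h : (box d n).card • ν.real (peakSet φ μ G Set.univ) ≤
        ∑ t ∈ box d n, ν.real (peakSet φ μ G {r | r + t ∈ box d n}) :=
      Finset.card_nsmul_le_sum _ _ _ fun t _ =>
        measureReal_mono (peakSet_anti φ μ G (Set.subset_univ _))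
    rw [card_box, nsmul_eq_mul, Nat.cast_pow] at h
    rw [hI, one_div_mul_eq_div, le_div_iff₀ hn', mul_comm]
    exact h
  · filter_upwards [eventually_gt_atTop 0] with n hn
    have hn' : (0 : ℝ) < (n : ℝ) ^ d := by positivity
    have hsub := innerBox_subset d n k
    have h1 : ∑ t ∈ innerBox d n k, ν.real (peakSet φ μ G {r | r + t ∈ box d n}) ≤
        (innerBox d n k).card • ν.real (peakSet φ μ G (K k)) :=
      Finset.sum_le_card_nsmul _ _ _ fun t ht =>
        measureReal_mono (peakSet_anti φ μ G fun r hr => add_mem_box ht hr)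
    have h2 : ∑ t ∈ box d n \ innerBox d n k, ν.real (peakSet φ μ G {r | r + t ∈ box d n}) ≤
        (box d n \ innerBox d n k).card • ν.real Set.univ :=
      Finset.sum_le_card_nsmul _ _ _ fun t ht => measureReal_mono (Set.subset_univ _)
    have hle : (n - 2 * k) ^ d ≤ n ^ d := Nat.pow_le_pow_left (Nat.sub_le _ _) d
    rw [Finset.card_sdiff_of_subset hsub, card_box, card_innerBox, nsmul_eq_mul,
      Nat.cast_sub hle, Nat.cast_pow, Nat.cast_pow] at h2
    rw [card_innerBox, nsmul_eq_mul, Nat.cast_pow] at h1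
    have h3 : ((n - 2 * k : ℕ) : ℝ) ^ d * ν.real (peakSet φ μ G (K k)) ≤
        (n : ℝ) ^ d * ν.real (peakSet φ μ G (K k)) :=
      mul_le_mul_of_nonneg_right (by exact_mod_cast hle) measureReal_nonneg
    rw [hI, one_div_mul_eq_div, div_le_iff₀ hn', ← Finset.sum_sdiff hsub, div_pow]
    have h4 : (ν.real (peakSet φ μ G (K k)) +
        (1 - ((n - 2 * k : ℕ) : ℝ) ^ d / (n : ℝ) ^ d) * ν.real Set.univ) * (n : ℝ) ^ d =
        (n : ℝ) ^ d * ν.real (peakSet φ μ G (K k)) +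
        ((n : ℝ) ^ d - ((n - 2 * k : ℕ) : ℝ) ^ d) * ν.real Set.univ := by
      field_simp
    rw [h4]
    linarith

/-- Nonsingularity carries the a.e. identity `hg` to all points of almost every countable orbit. -/
theorem ae_maxDual_eq (hφ : IsNonsingularAction φ μ) [SigmaFinite μ] {G : S → ℝ≥0∞}
    (hG : Measurable G) (hfin : ∫⁻ s, G s ∂μ ≠ ∞) {g : S → ℝ}
    (hg : g =ᵐ[μ] fun s => (G s).toReal) :
    ∀ᵐ s ∂μ, ∀ n, maxDual φ μ n g s = (⨆ t ∈ box d n, transfer φ μ t G s).toReal := by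
  filter_upwards [hφ.ae_all_comp hg, hφ.ae_transfer_ne_top hG hfin] with s hs hs' n
  have h : (⨆ t ∈ box d n, transfer φ μ t G s) =
      ⨆ t : Set.Icc (0 : Fin d → ℤ) (fun _ => (n : ℤ) - 1), transfer φ μ t G s := by
    rw [iSup_subtype]
    simp only [box, Finset.mem_Icc, Set.mem_Icc]
  rw [h, ENNReal.toReal_iSup (f := fun t : Set.Icc (0 : Fin d → ℤ) (fun _ => (n : ℤ) - 1) =>
    transfer φ μ t G s) fun t => hs' t, maxDual]
  refine iSup_congr fun t => ?_
  rw [dualOp, hs, transfer, ENNReal.toReal_mul, jac]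

theorem lintegral_iSup_transfer_ne_top (hφ : IsNonsingularAction φ μ) [SigmaFinite μ]
    {G : S → ℝ≥0∞} (hG : Measurable G) (hfin : ∫⁻ s, G s ∂μ ≠ ∞) (F : Finset (Fin d → ℤ)) :
    ∫⁻ s, ⨆ t ∈ F, transfer φ μ t G s ∂μ ≠ ∞ := by
  have := isFiniteMeasure_withDensity hfin
  rw [hφ.lintegral_iSup_transfer hG hfin]
  exact ENNReal.sum_ne_top.2 fun t _ => measure_ne_top _ _

theorem measurable_iSup_transfer (hφ : IsNonsingularAction φ μ) {G : S → ℝ≥0∞}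
    (hG : Measurable G) (F : Finset (Fin d → ℤ)) :
    Measurable fun s => ⨆ t ∈ F, transfer φ μ t G s :=
  Measurable.iSup fun t => Measurable.iSup fun _ => hφ.measurable_transfer t hG

theorem integrable_maxDual (hφ : IsNonsingularAction φ μ) [SigmaFinite μ] {G : S → ℝ≥0∞}
    (hG : Measurable G) (hfin : ∫⁻ s, G s ∂μ ≠ ∞) {g : S → ℝ}
    (hg : g =ᵐ[μ] fun s => (G s).toReal) (n : ℕ) : Integrable (maxDual φ μ n g) μ :=
  (integrable_toReal_of_lintegral_ne_top (hφ.measurable_iSup_transfer hG _).aemeasurable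
    (hφ.lintegral_iSup_transfer_ne_top hG hfin (box d n))).congr
    ((hφ.ae_maxDual_eq hG hfin hg).mono fun _ h => (h n).symm)

/-- The averaged maxima converge to the mass of the first maximizers. -/
theorem tendsto_integral_maxDual (hφ : IsNonsingularAction φ μ) [SigmaFinite μ] {G : S → ℝ≥0∞}
    (hG : Measurable G) (hfin : ∫⁻ s, G s ∂μ ≠ ∞) {g : S → ℝ}
    (hg : g =ᵐ[μ] fun s => (G s).toReal) :
    Tendsto (fun n : ℕ => 1 / (n : ℝ) ^ d * ∫ s, maxDual φ μ n g s ∂μ) atTop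
      (𝓝 (∫⁻ s in peakSet φ μ G Set.univ, G s ∂μ).toReal) := by
  refine (hφ.tendsto_lintegral_iSup_transfer hG hfin).congr fun n => ?_
  rw [integral_congr_ae ((hφ.ae_maxDual_eq hG hfin hg).mono fun _ h => h n),
    integral_toReal (hφ.measurable_iSup_transfer hG _).aemeasurable
      (ae_lt_top (hφ.measurable_iSup_transfer hG _)
        (hφ.lintegral_iSup_transfer_ne_top hG hfin _))]

end IsNonsingularAction

/-- Nonnegative integrable functions agree almost everywhere with a measurable function into
`[0, ∞]` of finite integral. -/
theorem exists_measurable_toReal_ae_eq {μ : Measure S} {g : S → ℝ} (hg : Integrable g μ)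
    (hg0 : 0 ≤ᵐ[μ] g) : ∃ G : S → ℝ≥0∞, Measurable G ∧ ∫⁻ s, G s ∂μ ≠ ∞ ∧ (∀ s, G s ≠ ∞) ∧
      g =ᵐ[μ] fun s => (G s).toReal := by
  have hae : g =ᵐ[μ] hg.1.mk g := hg.1.ae_eq_mk
  refine ⟨fun s => ENNReal.ofReal (hg.1.mk g s),
    hg.1.stronglyMeasurable_mk.measurable.ennreal_ofReal, ?_, fun s => ENNReal.ofReal_ne_top, ?_⟩
  · have h : ∫⁻ s, ENNReal.ofReal (hg.1.mk g s) ∂μ = ∫⁻ s, ENNReal.ofReal (g s) ∂μ :=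
      lintegral_congr_ae (hae.mono fun s hs => by simp only [hs])
    rw [h]
    exact ((lintegral_ofReal_le_lintegral_enorm g).trans_lt hg.2).ne
  · filter_upwards [hae, hg0] with s hs hs0
    rw [← hs, ENNReal.toReal_ofReal hs0]

/-! ### Conservative actions -/

theorem IsNonsingularAction.measure_peakSet_univ {φ : (Fin d → ℤ) → S → S} {μ : Measure S}
    (hφ : IsNonsingularAction φ μ) [SigmaFinite μ] (hc : IsConservative φ μ) {G : S → ℝ≥0∞}
    (hG : Measurable G) : μ (peakSet φ μ G Set.univ) = 0 := by
  -- Wandering demands exact disjointness, so the non-regular points are removed within a measurable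
  -- null set.
  obtain ⟨N, hN, hNm, hN0⟩ := exists_measurable_superset_of_null (ae_iff.1 hφ.ae_isRegularPoint)
  have hreg : ∀ s ∉ N, IsRegularPoint φ μ s := fun s hs => by
    by_contra h
    exact hs (hN h)
  have hwand : IsWandering φ (peakSet φ μ G Set.univ \ N) := by
    refine ⟨(hφ.measurableSet_peakSet hG _).diff hNm, fun u v huv => ?_⟩
    refine Set.disjoint_left.2 ?_
    rintro s ⟨hu, huN⟩ ⟨hv, -⟩
    have hv' : φ v s = φ (v - u) (φ u s) := by rw [← hφ.map_add, sub_add_cancel]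
    have hpeak := hφ.isPeak_transfer_iff (hreg _ huN) G Set.univ (v - u)
    simp only [Set.mem_univ, ← hv'] at hpeak
    have h0 : v - u = 0 := (hpeak.2 hv).eq hu (Set.mem_univ _) (Set.mem_univ _)
    exact huv (sub_eq_zero.1 h0).symm
  rw [← measure_sdiff_null hN0]
  exact hc _ hwand

/-! ### Dissipative actions -/

theorem IsWandering.preimage {φ : (Fin d → ℤ) → S → S} {μ : Measure S}
    (hφ : IsNonsingularAction φ μ) {W : Set S} (hW : IsWandering φ W) (t : Fin d → ℤ) :
    IsWandering φ (φ t ⁻¹' W) := by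
  refine ⟨hφ.measurable t hW.measurableSet, fun u v huv => ?_⟩
  have h : ∀ u, φ u ⁻¹' (φ t ⁻¹' W) = φ (t + u) ⁻¹' W := fun u => by
    ext s
    simp only [Set.mem_preimage, hφ.map_add]
  simp only [h]
  exact hW.pairwise_disjoint fun h => huv (add_left_cancel h)

namespace IsNonsingularAction

variable {φ : (Fin d → ℤ) → S → S} {μ : Measure S}

/-- The `t`-th term integrates over `W` to the integral of `G` over `φ t '' W`, and these images are
disjoint. -/
theorem lintegral_tsum_transfer_le (hφ : IsNonsingularAction φ μ) [SigmaFinite μ] {W : Set S}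
    (hW : IsWandering φ W) {G : S → ℝ≥0∞} (hG : Measurable G) :
    ∫⁻ s in W, ∑' t, transfer φ μ t G s ∂μ ≤ ∫⁻ s, G s ∂μ := by
  have hm : ∀ t, MeasurableSet (φ (-t) ⁻¹' W) := fun t => hφ.measurable _ hW.measurableSet
  have h : ∀ t, ∫⁻ s in W, transfer φ μ t G s ∂μ = ∫⁻ s in φ (-t) ⁻¹' W, G s ∂μ := fun t => by
    rw [← lintegral_indicator hW.measurableSet, ← lintegral_indicator (hm t),
      ← hφ.lintegral_transfer t (hG.indicator (hm t))]
    refine lintegral_congr fun s => ?_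
    by_cases hs : s ∈ W <;> simp [transfer, Set.indicator, hs, hφ.neg_apply]
  rw [lintegral_tsum fun t => (hφ.measurable_transfer t hG).aemeasurable]
  simp_rw [h]
  rw [← lintegral_iUnion hm fun u v huv => hW.pairwise_disjoint fun h => huv (neg_injective h)]
  exact setLIntegral_le_lintegral _ _

theorem ae_tsum_transfer_ne_top (hφ : IsNonsingularAction φ μ) [SigmaFinite μ]
    (hd : IsDissipative φ μ) {G : S → ℝ≥0∞} (hG : Measurable G) (hfin : ∫⁻ s, G s ∂μ ≠ ∞) :
    ∀ᵐ s ∂μ, ∑' t, transfer φ μ t G s ≠ ∞ := by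
  obtain ⟨W, hW, hcov⟩ := hd
  have hsum : Measurable fun s => ∑' t, transfer φ μ t G s :=
    Measurable.tsum fun t => hφ.measurable_transfer t hG
  have h : ∀ᵐ s ∂μ, ∀ u, s ∈ φ u ⁻¹' W → ∑' t, transfer φ μ t G s ≠ ∞ :=
    ae_all_iff.2 fun u => by
      have hu := hW.preimage hφ u
      rw [← ae_restrict_iff' hu.measurableSet]
      exact (ae_lt_top hsum
        ((hφ.lintegral_tsum_transfer_le hu hG).trans_lt hfin.lt_top).ne).mono fun _ h => h.ne
  have hcov' : ∀ᵐ s ∂μ, s ∈ ⋃ t, φ t ⁻¹' W := mem_ae_iff.2 hcov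
  filter_upwards [h, hcov'] with s hs hs'
  obtain ⟨u, hu⟩ := Set.mem_iUnion.1 hs'
  exact hs u hu

/-- If `G` vanished a.e. on the peak set, then along almost every orbit the value at the first
maximizer would be 0, yet it dominates the value `G s` at time 0. -/
theorem setLIntegral_peakSet_ne_zero (hφ : IsNonsingularAction φ μ) [SigmaFinite μ]
    (hd : IsDissipative φ μ) {G : S → ℝ≥0∞} (hG : Measurable G) (hfin : ∫⁻ s, G s ∂μ ≠ ∞)
    (hpos : ¬ G =ᵐ[μ] 0) : ∫⁻ s in peakSet φ μ G Set.univ, G s ∂μ ≠ 0 := by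
  intro h0
  rw [setLIntegral_eq_zero_iff (hφ.measurableSet_peakSet hG _) hG] at h0
  refine hpos ?_
  filter_upwards [hφ.ae_all_comp h0, hφ.ae_isRegularPoint,
    hφ.ae_tsum_transfer_ne_top hd hG hfin] with s h0 hs hsum
  by_contra hne
  have hne' : transfer φ μ 0 G s ≠ 0 := by rwa [hφ.transfer_zero hs]
  obtain ⟨t, -, ht, hle⟩ := exists_isPeak (F := Set.univ) (h := fun t => transfer φ μ t G s)
    (by simpa only [Set.indicator_univ] using hsum) (Set.mem_univ 0) hne'
  rw [hφ.isPeak_transfer_iff hs] at ht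
  simp only [Set.mem_univ] at ht
  have : transfer φ μ t G s = 0 := by rw [transfer, h0 t ht, zero_mul]
  exact hne' (le_zero_iff.1 (hle.trans_eq this))

end IsNonsingularAction

/-! ### The shift on `W × ℤ^d` -/

section Krengel

theorem ae_of_ae_prod_count {W : Type*} [MeasurableSpace W] (τ : Measure W)
    {p : W × (Fin d → ℤ) → Prop}
    (hp : ∀ᵐ z ∂(τ.prod Measure.count), p z) : ∀ᵐ w ∂τ, ∀ s, p (w, s) :=
  (Measure.ae_ae_of_ae_prod hp).mono fun w hw => by
    rwa [Measure.ae_count_iff] at hw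

variable {W : Type*} [MeasurableSpace W] (τ : Measure W) [SigmaFinite τ]

theorem measurable_krengelAction {W : Type*} [MeasurableSpace W] (t : Fin d → ℤ) :
    Measurable (krengelAction t : W × (Fin d → ℤ) → W × (Fin d → ℤ)) :=
  measurable_fst.prodMk (measurable_snd.const_add t)

theorem map_krengelAction (t : Fin d → ℤ) :
    (τ.prod (Measure.count : Measure (Fin d → ℤ))).map (krengelAction t) =
      τ.prod Measure.count := by
  have h := map_add_left_eq_self (Measure.count : Measure (Fin d → ℤ)) t
  have h2 := Measure.map_prod_map τ (Measure.count : Measure (Fin d → ℤ)) measurable_id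
    (measurable_const_add t)
  rw [Measure.map_id, h] at h2
  exact h2.symm

theorem isNonsingularAction_krengelAction :
    IsNonsingularAction (krengelAction (d := d) (W := W)) (τ.prod Measure.count) where
  measurable := measurable_krengelAction
  map_zero s := by simp [krengelAction]
  map_add u v s := by simp [krengelAction, add_assoc]
  map_absolutelyContinuous t := by rw [map_krengelAction]
  absolutelyContinuous_map t := by rw [map_krengelAction]

theorem ae_jac_krengelAction :
    ∀ᵐ p ∂(τ.prod (Measure.count : Measure (Fin d → ℤ))), ∀ t,
      jac krengelAction (τ.prod Measure.count) t p = 1 :=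
  ae_all_iff.2 fun t => by
    rw [jac, compMeasure, map_krengelAction]
    exact Measure.rnDeriv_self _

/-- The shift preserves the measure, so its Radon–Nikodym factor is 1 and `(w, s)` lies in the peak
set exactly when `s` is the first maximizer of `F (w, ·)`. Each fibre thus contributes its supremum.
-/
theorem setLIntegral_peakSet_krengelAction {F : W × (Fin d → ℤ) → ℝ≥0∞} (hF : Measurable F)
    (hfin : ∫⁻ p, F p ∂(τ.prod Measure.count) ≠ ∞) :
    ∫⁻ p in peakSet krengelAction (τ.prod Measure.count) F Set.univ, F p ∂(τ.prod Measure.count) =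
      ∫⁻ w, ⨆ s, F (w, s) ∂τ := by
  classical
  have hA := (isNonsingularAction_krengelAction (d := d) τ).measurableSet_peakSet hF Set.univ
  have hsum : ∀ᵐ w ∂τ, ∑' s, F (w, s) < ∞ := by
    rw [lintegral_prod _ hF.aemeasurable] at hfin
    simp_rw [lintegral_count] at hfin
    exact ae_lt_top (Measurable.tsum fun s => hF.comp measurable_prodMk_right) hfin
  rw [← lintegral_indicator hA, lintegral_prod _ (hF.indicator hA).aemeasurable]
  refine lintegral_congr_ae ?_
  filter_upwards [hsum, ae_of_ae_prod_count τ (ae_jac_krengelAction τ)] with w hw hj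
  have h := tsum_isPeak_eq_iSup (F := Set.univ) (h := fun s => F (w, s))
    (by simpa only [Set.indicator_univ] using hw.ne)
  simp only [Set.mem_univ, true_and, iSup_pos] at h
  rw [lintegral_count, ← h]
  refine tsum_congr fun s => ?_
  have hiff := isPeak_add_iff (F := Set.univ) (h := fun s => F (w, s))
    (h' := fun r => transfer krengelAction (τ.prod Measure.count) r F (w, s)) (t := s)
    one_ne_zero ENNReal.one_ne_top fun r => by rw [transfer, hj, mul_one, mul_one, krengelAction]
  rw [Set.indicator_apply]
  exact if_congr hiff.symm rfl rfl

end Krengel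

theorem not_ae_eq_zero {μ : Measure S} {g : S → ℝ}
    {G : S → ℝ≥0∞} (hg : g =ᵐ[μ] fun s => (G s).toReal) (hpos : 0 < μ {s | 0 < g s}) :
    ¬ G =ᵐ[μ] 0 := by
  intro h
  refine hpos.ne' (measure_mono_null (fun s hs => ?_) (ae_iff.1 (hg.and h)))
  rintro ⟨h1, h2⟩
  have hs : 0 < g s := hs
  simp [h1, h2] at hs

end ZdAction

end

theorem proposition3p1 (d : ℕ) :
    -- (a) conservative actions
    (∀ {S : Type*} [MeasurableSpace S] [StandardBorelSpace S] (μ : Measure S) [SigmaFinite μ]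
        (φ : (Fin d → ℤ) → S → S), ZdAction.IsNonsingularAction φ μ →
        ZdAction.IsConservative φ μ →
        ∀ g : S → ℝ, Integrable g μ → 0 ≤ᵐ[μ] g →
          (∀ n : ℕ, 1 ≤ n → Integrable (ZdAction.maxDual φ μ n g) μ) ∧
          Tendsto (fun n : ℕ => 1 / (n : ℝ) ^ d * ∫ s, ZdAction.maxDual φ μ n g s ∂μ)
            atTop (𝓝 0)) ∧
    -- (b) dissipative actions
    (∀ {S : Type*} [MeasurableSpace S] [StandardBorelSpace S] (μ : Measure S) [SigmaFinite μ]
        (φ : (Fin d → ℤ) → S → S), ZdAction.IsNonsingularAction φ μ →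
        ZdAction.IsDissipative φ μ →
        ∀ g : S → ℝ, Integrable g μ → 0 ≤ᵐ[μ] g → 0 < μ {s | 0 < g s} →
          (∀ n : ℕ, 1 ≤ n → Integrable (ZdAction.maxDual φ μ n g) μ) ∧
          ∃ a : ℝ, 0 < a ∧
            Tendsto (fun n : ℕ => 1 / (n : ℝ) ^ d * ∫ s, ZdAction.maxDual φ μ n g s ∂μ)
              atTop (𝓝 a)) ∧
    -- the value of the limit for the shift on `W × ℤ^d` with the measure `τ ⊗ counting`
    (∀ {W : Type*} [MeasurableSpace W] [StandardBorelSpace W] (τ : Measure W) [SigmaFinite τ]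
        (f : W × (Fin d → ℤ) → ℝ), Integrable f (τ.prod Measure.count) →
        0 ≤ᵐ[τ.prod Measure.count] f → 0 < (τ.prod Measure.count) {p | 0 < f p} →
          Integrable (fun w => ⨆ s : Fin d → ℤ, f (w, s)) τ ∧
          0 < ∫ w, ⨆ s : Fin d → ℤ, f (w, s) ∂τ ∧
          Tendsto (fun n : ℕ => 1 / (n : ℝ) ^ d *
              ∫ p, ZdAction.maxDual ZdAction.krengelAction (τ.prod Measure.count) n f p
                ∂(τ.prod Measure.count))
            atTop (𝓝 (∫ w, ⨆ s : Fin d → ℤ, f (w, s) ∂τ))) := by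
  refine ⟨?_, ?_, ?_⟩
  · intro S _ _ μ _ φ hφ hc g hg hg0
    obtain ⟨G, hG, hfin, -, hgG⟩ := ZdAction.exists_measurable_toReal_ae_eq hg hg0
    refine ⟨fun n _ => hφ.integrable_maxDual hG hfin hgG n, ?_⟩
    have h := hφ.tendsto_integral_maxDual hG hfin hgG
    rwa [setLIntegral_measure_zero _ _ (hφ.measure_peakSet_univ hc hG), ENNReal.toReal_zero] at h
  · intro S _ _ μ _ φ hφ hd g hg hg0 hpos
    obtain ⟨G, hG, hfin, -, hgG⟩ := ZdAction.exists_measurable_toReal_ae_eq hg hg0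
    exact ⟨fun n _ => hφ.integrable_maxDual hG hfin hgG n, _, ENNReal.toReal_pos
      (hφ.setLIntegral_peakSet_ne_zero hd hG hfin (ZdAction.not_ae_eq_zero hgG hpos))
      ((setLIntegral_le_lintegral _ _).trans_lt hfin.lt_top).ne,
      hφ.tendsto_integral_maxDual hG hfin hgG⟩
  · intro W _ _ τ _ f hf hf0 hpos
    obtain ⟨F, hF, hfin, hFtop, hfF⟩ := ZdAction.exists_measurable_toReal_ae_eq hf hf0
    have hφ := ZdAction.isNonsingularAction_krengelAction (d := d) τ
    have hsup : Measurable fun w => ⨆ s, F (w, s) :=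
      Measurable.iSup fun s => hF.comp measurable_prodMk_right
    have hval := ZdAction.setLIntegral_peakSet_krengelAction τ hF hfin
    have hsup_fin : ∫⁻ w, ⨆ s, F (w, s) ∂τ ≠ ⊤ := by
      rw [← hval]
      exact ((setLIntegral_le_lintegral _ _).trans_lt hfin.lt_top).ne
    have hfsup : (fun w => ⨆ s, f (w, s)) =ᵐ[τ] fun w => (⨆ s, F (w, s)).toReal := by
      filter_upwards [ZdAction.ae_of_ae_prod_count τ hfF] with w hw
      -- Where the supremum is infinite, both the real supremum and `toReal` take the default value
      -- 0.
      rw [ENNReal.toReal_iSup fun s => hFtop (w, s)]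
      exact iSup_congr hw
    have hint : ∫ w, ⨆ s, f (w, s) ∂τ = (∫⁻ w, ⨆ s, F (w, s) ∂τ).toReal := by
      rw [integral_congr_ae hfsup, integral_toReal hsup.aemeasurable (ae_lt_top hsup hsup_fin)]
    refine ⟨(integrable_toReal_of_lintegral_ne_top hsup.aemeasurable hsup_fin).congr hfsup.symm,
      ?_, ?_⟩
    · rw [hint]
      refine ENNReal.toReal_pos (fun h0 => ?_) hsup_fin
      -- A zero integral of the supremum forces `F` to vanish on almost every fibre.
      refine ZdAction.not_ae_eq_zero hfF hpos ?_
      rw [lintegral_eq_zero_iff hsup] at h0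
      rw [← lintegral_eq_zero_iff hF, lintegral_prod _ hF.aemeasurable,
        lintegral_eq_zero_iff' hF.lintegral_prod_right'.aemeasurable]
      filter_upwards [h0] with w hw
      have hw' : ∀ s, F (w, s) = 0 := by simpa using hw
      simp [hw']
    · rw [hint, ← hval]
      exact hφ.tendsto_integral_maxDual hF hfin hfF
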